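/- Setting. For a block length $n$ the channel is $Y_t=X_t+Z_t$, $t=1,\dots,n$, with $Z_1,\dots,Z_n$ i.i.d. Gaussian of mean $0$ and variance $\sigma^2>0$. Before transmission a helper, who knows $(Z_1,\dots,Z_n)$ but not the message, delivers a description $T=T(Z_1,\dots,Z_n)$ with at most $e^{nR_{\mathrm h}}$ values, i.e. $T\in\{1,\dots,\lfloor e^{nR_{\mathrm h}}\rfloor\}$, either to the transmitter only or to the receiver only. The input must satisfy the total energy constraint $\sum_{t=1}^n\mathbb E[X_t^2]\le E$ for every message. Here $\sigma^2>0$, $E>0$, $R_{\mathrm h}>0$ do not depend on $n$, and $\gamma=E/\sigma^2$. All logarithms are natural. A *helper-assisted PPM-based scheme* conveys a pair of submessages $w=(w_{\mathrm h},w_\ell)\in\{1,\dots,M_1\}\times\{1,\dots,M_2\}$ as follows: in the first $k$ time steps a code for $w_{\mathrm h}$ is used, with help about the noise in these $k$ steps only, and $w_{\mathrm h}$ is decoded from these steps (and from $T$, if the receiver is the assisted terminal); in the remaining $n-k\ge M_2$ steps, without help, $X_{k+j}=\sqrt{E'}\,\delta_{j,w_\ell}$ for some $E'\ge 0$, and $\hat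 w_\ell\in\arg\max_{1\le j\le M_2}Y_{k+j}$. A set of $M$ messages is conveyed by labelling them with distinct pairs; $L=\log M$. Theorem. For either location of the helper (transmitter only or receiver only) there is a sequence $\eta_n\to 0$ (so that $e^{\eta_n}=e^{o(n)}$) such that for every $\mathcal E_\infty>0$ and every $\delta>0$, for all sufficiently large $n$ and every integer $M\ge1$ with $L=\log M<\gamma/2+nR_{\mathrm h}$, there is a helper-assisted PPM-based scheme satisfying the energy constraint, with some $M_1\ge 1$ and $M_2=\lceil M/M_1\rceil$ (hence $M_1M_2\ge M$), such that for every message $w$ $$\Pr\{\hat W\ne w\}\le e^{\eta_n}\cdot\begin{cases}e^{-n\mathcal E_\infty}, & L<nR_{\mathrm h},\\ e^{-\left(\frac{\gamma}{4}-L+nR_{\mathrm h}\right)}, & 0\le L-nR_{\mathrm h}<\frac{\gamma}{8},\\ e^{-\left(\sqrt{\gamma/2}-\sqrt{L-nR_{\mathrm h}}\right)^2}, & \frac{\gamma}{8}\le L-nR_{\mathrm h}<\frac{\gamma}{2}.\end{cases}$$ Moreover, if $L\in[nR_{\mathrm h},\,\gamma/2+nR_{\mathrm h})$, the same scheme conveys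 in $w_{\mathrm h}$ an amount of $L'=\log M_1$ nats with $nR_{\mathrm h}-\delta<L'<nR_{\mathrm h}$ and $\Pr\{\hat w_{\mathrm h}\ne w_{\mathrm h}\}\le e^{-n\mathcal E_\infty}$ for every $w$, whereas the remaining nats, those of $w_\ell$, are conveyed with $\Pr\{\hat w_\ell\ne w_\ell\}$ bounded by the right-hand side of the displayed bound for every $w$. -/

import Mathlib

open MeasureTheory ProbabilityTheory Filter Topology
open scoped NNReal

noncomputable section

/-- The law of the noise sequence `Z₁, …, Zₙ`: i.i.d. Gaussian, zero mean, variance `v`. -/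
def awgnNoise (n : ℕ) (v : ℝ≥0) : Measure (Fin n → ℝ) :=
  Measure.pi fun _ => gaussianReal 0 v

/-- Which terminal obtains the helper's description. -/
inductive HelperSide
  | transmitter
  | receiver

/-- A code of block length `n` over the additive noise channel `Y = X + Z` with a helper that has
`Mh` descriptions, for messages that are pairs `w = (w_h, w_ℓ)`. The helper sees the whole noise
sequence, noncausally, but not the message. Both terminals are written as functions of the
description; `AssistsOnly` says which one of them may really use it. -/
structure HelperCode (n Mh M₁ M₂ : ℕ) where
  /-- the helper's description of the noise sequence -/
  help : (Fin n → ℝ) → Fin Mh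
  /-- the channel input sequence for a message and a description -/
  enc : Fin M₁ × Fin M₂ → Fin Mh → Fin n → ℝ
  /-- the decoded message for an output sequence and a description -/
  dec : (Fin n → ℝ) → Fin Mh → Fin M₁ × Fin M₂
  measurable_help : Measurable help
  measurable_dec : ∀ m, Measurable fun y => dec y m

namespace HelperCode

variable {n Mh M₁ M₂ : ℕ}

/-- Only the given terminal uses the helper's description. -/
def AssistsOnly (c : HelperCode n Mh M₁ M₂) : HelperSide → Prop
  | HelperSide.transmitter => ∀ y m m', c.dec y m = c.dec y m'
  | HelperSide.receiver => ∀ w m m', c.enc w m = c.enc w m'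

/-- The total energy constraint `∑ₜ E[Xₜ²] ≤ E`, for every message. -/
def EnergyLE (c : HelperCode n Mh M₁ M₂) (v : ℝ≥0) (E : ℝ) : Prop :=
  ∀ w, ∫ z, ∑ t, (c.enc w (c.help z) t) ^ 2 ∂(awgnNoise n v) ≤ E

/-- The decoder's output when `w` is sent and the noise sequence is `z`. -/
def decoded (c : HelperCode n Mh M₁ M₂) (w : Fin M₁ × Fin M₂) (z : Fin n → ℝ) :
    Fin M₁ × Fin M₂ :=
  c.dec (fun t => c.enc w (c.help z) t + z t) (c.help z)

/-- The probability that `w = (w_h, w_ℓ)` is decoded wrongly, given that it is sent. -/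
def errorProb (c : HelperCode n Mh M₁ M₂) (v : ℝ≥0) (w : Fin M₁ × Fin M₂) : ℝ :=
  (awgnNoise n v).real {z | c.decoded w z ≠ w}

/-- The probability that the submessage `w_h` is decoded wrongly, given that `w` is sent. -/
def errorProbHigh (c : HelperCode n Mh M₁ M₂) (v : ℝ≥0) (w : Fin M₁ × Fin M₂) : ℝ :=
  (awgnNoise n v).real {z | (c.decoded w z).1 ≠ w.1}

/-- The probability that the submessage `w_ℓ` is decoded wrongly, given that `w` is sent. -/
def errorProbLow (c : HelperCode n Mh M₁ M₂) (v : ℝ≥0) (w : Fin M₁ × Fin M₂) : ℝ :=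
  (awgnNoise n v).real {z | (c.decoded w z).2 ≠ w.2}

/-- The code is a helper-assisted scheme based on pulse position modulation. The block is divided
into the first `k` time steps and the others. The help concerns only the noise of the first `k`
steps; these steps carry `w_h`, which is decoded from them (and from the description). The other
steps carry `w_ℓ` without help by a single pulse of energy `e` at position `w_ℓ`, and `w_ℓ` is
decoded as a position of the largest output among the `M₂` positions. -/
def IsPPMBased (c : HelperCode n Mh M₁ M₂) : Prop :=
  ∃ (k : ℕ) (e : ℝ), k + M₂ ≤ n ∧ 0 ≤ e ∧
    (∀ z z' : Fin n → ℝ, (∀ t : Fin n, (t : ℕ) < k → z t = z' t) → c.help z = c.help z') ∧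
    (∀ w w' m, w.1 = w'.1 → ∀ t : Fin n, (t : ℕ) < k → c.enc w m t = c.enc w' m t) ∧
    (∀ w m, ∀ t : Fin n, k ≤ (t : ℕ) →
      c.enc w m t = if (t : ℕ) = k + (w.2 : ℕ) then √e else 0) ∧
    (∀ (y y' : Fin n → ℝ) (m : Fin Mh),
      (∀ t : Fin n, (t : ℕ) < k → y t = y' t) → (c.dec y m).1 = (c.dec y' m).1) ∧
    (∀ (y : Fin n → ℝ) (m : Fin Mh) (s t : Fin n), k ≤ (s : ℕ) → (s : ℕ) < k + M₂ →
      (t : ℕ) = k + ((c.dec y m).2 : ℕ) → y s ≤ y t)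

end HelperCode

/-- The exponent of the error bound as a function of the number `L` of nats to be conveyed, at help
rate `Rh` per time step, block length `n` and energy-to-noise ratio `γ`; `Einf` stands for the
arbitrarily large exponent. Used for `L < γ / 2 + n * Rh` only. -/
def helperExponent (γ Rh Einf : ℝ) (n : ℕ) (L : ℝ) : ℝ :=
  if L < n * Rh then n * Einf
  else if L - n * Rh < γ / 8 then γ / 4 - L + n * Rh
  else (√(γ / 2) - √(L - n * Rh)) ^ 2

end

/-! Help is worth `n * Rh` nats at negligible energy and without any error. In a single time step
both noise and input are measured on a grid of fineness `a`. The helper gives the grid cell of the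
noise modulo `Mh`, and whichever terminal knows it subtracts it, so `w_h` is recovered exactly as a
residue (`exists_ppmBased_code`). Only `M₂`, about `M / exp (n * Rh)`, pulse positions remain. This
number is bounded in `n`, so they fit into the block. Gallager's bound with parameter `ρ`
(`measure_exists_add_le_awgnNoise_le`) controls their error, and optimizing `ρ` gives the two
regimes of the exponent (`exists_gallager_parameter`). -/

/-! ### Gallager's bound for pulse position modulation. -/

theorem integrable_exp_sum_awgnNoise {n : ℕ} (v : ℝ≥0) (a : Fin n → ℝ) :
    Integrable (fun z => Real.exp (∑ i, a i * z i)) (awgnNoise n v) := by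
  simp only [Real.exp_sum]
  exact Integrable.fintype_prod (μ := fun _ => gaussianReal 0 v)
    (f := fun i x => Real.exp (a i * x)) fun i => integrable_exp_mul_gaussianReal (a i)

theorem integral_exp_sum_awgnNoise {n : ℕ} (v : ℝ≥0) (a : Fin n → ℝ) :
    ∫ z, Real.exp (∑ i, a i * z i) ∂(awgnNoise n v) = Real.exp (v * (∑ i, a i ^ 2) / 2) := by
  simp only [Real.exp_sum]
  rw [awgnNoise, integral_fintype_prod_eq_prod (μ := fun _ => gaussianReal 0 v)
    (f := fun i x => Real.exp (a i * x)), Finset.mul_sum, Finset.sum_div, Real.exp_sum]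
  refine Finset.prod_congr rfl fun i _ => ?_
  have := congrFun (mgf_id_gaussianReal (μ := 0) (v := v)) (a i)
  simpa [mgf] using this

/-- On the event, `B = ∑ exp (s * z j)` is at least `exp (s * (A + z p))`, so `exp (-(s * (A + z p)
* ρ)) * B ^ ρ ≥ 1`. Replacing the concave `B ^ ρ` by its tangent at the mean of `B` makes the bound
a combination of exponentials of linear forms, integrable in closed form. This does the work of
Jensen's inequality. -/
theorem measure_exists_add_le_awgnNoise_le {n : ℕ} {v : ℝ≥0} (hv : 0 < v) (p : Fin n)
    (S : Finset (Fin n)) (hp : p ∉ S) (A : ℝ) (hA : 0 ≤ A) {ρ : ℝ} (hρ : 0 < ρ) (hρ1 : ρ ≤ 1) :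
    (awgnNoise n v).real {z | ∃ j ∈ S, A + z p ≤ z j} ≤
      (S.card : ℝ) ^ ρ * Real.exp (-(ρ * (A ^ 2 / v) / (2 * (1 + ρ)))) := by
  have : IsProbabilityMeasure (awgnNoise n v) := by unfold awgnNoise; infer_instance
  rcases S.eq_empty_or_nonempty with rfl | hS
  · simp [Real.zero_rpow hρ.ne']
  have hv' : (0 : ℝ) < v := hv
  have hK : (0 : ℝ) < S.card := by exact_mod_cast hS.card_pos
  -- The minimizer of the final exponent `v * ρ * (1 + ρ) * s ^ 2 / 2 - s * ρ * A`.
  set s : ℝ := A / ((1 + ρ) * v) with hs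
  have hs0 : 0 ≤ s := by positivity
  -- The mean of `B`, where the tangent is taken.
  set c : ℝ := S.card * Real.exp (v * s ^ 2 / 2) with hc
  have hc0 : 0 < c := by positivity
  let a₀ : Fin n → ℝ := fun i => if i = p then -(s * ρ) else 0
  let a : Fin n → Fin n → ℝ := fun j i => a₀ i + if i = j then s else 0
  have h0 : ∀ z : Fin n → ℝ, ∑ i, a₀ i * z i = -(s * ρ) * z p := fun z => by simp [a₀]
  have h1 : ∀ j (z : Fin n → ℝ), ∑ i, a j i * z i = -(s * ρ) * z p + s * z j := fun j z => by
    simp only [a, add_mul, Finset.sum_add_distrib, h0]; simp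
  have q0 : ∑ i, a₀ i ^ 2 = (s * ρ) ^ 2 := by simp [a₀, ite_pow]
  have q1 : ∀ j ∈ S, ∑ i, a j i ^ 2 = (s * ρ) ^ 2 + s ^ 2 := fun j hj => by
    have hjp : j ≠ p := fun h => hp (h ▸ hj)
    have : ∀ i, a j i ^ 2 = a₀ i ^ 2 + if i = j then s ^ 2 else 0 := fun i => by
      by_cases hi : i = j
      · subst hi; simp [a, a₀, hjp]
      · simp [a, hi]
    simp only [this, Finset.sum_add_distrib, q0]; simp
  let f : (Fin n → ℝ) → ℝ := fun z => c ^ ρ * Real.exp (-(s * ρ * A)) *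
    ((1 - ρ) * Real.exp (∑ i, a₀ i * z i) + ρ / c * ∑ j ∈ S, Real.exp (∑ i, a j i * z i))
  have i0 := integrable_exp_sum_awgnNoise v a₀
  have i1 : Integrable (fun z => ∑ j ∈ S, Real.exp (∑ i, a j i * z i)) (awgnNoise n v) :=
    integrable_finsetSum _ fun j _ => integrable_exp_sum_awgnNoise v (a j)
  have hf : Integrable f (awgnNoise n v) :=
    ((i0.const_mul _).add (i1.const_mul _)).const_mul _
  have hf0 : ∀ z, 0 ≤ f z := fun z => by
    have : 0 ≤ 1 - ρ := by linarith
    positivity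
  have hint : ∫ z, f z ∂(awgnNoise n v) =
      (S.card : ℝ) ^ ρ * Real.exp (-(ρ * (A ^ 2 / v) / (2 * (1 + ρ)))) := by
    simp only [f]
    rw [integral_const_mul, integral_add (i0.const_mul _) (i1.const_mul _), integral_const_mul,
      integral_const_mul, integral_finsetSum _ fun j _ => integrable_exp_sum_awgnNoise v (a j)]
    simp only [integral_exp_sum_awgnNoise]
    have e0 : ∑ j ∈ S, Real.exp (v * (∑ i, a j i ^ 2) / 2) =
        S.card * Real.exp (v * ((s * ρ) ^ 2 + s ^ 2) / 2) := by
      rw [Finset.sum_congr rfl fun j hj => by rw [q1 j hj], Finset.sum_const, nsmul_eq_mul]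
    rw [e0, q0]
    have e1 : Real.exp (v * ((s * ρ) ^ 2 + s ^ 2) / 2) =
        Real.exp (v * (s * ρ) ^ 2 / 2) * Real.exp (v * s ^ 2 / 2) := by
      rw [← Real.exp_add]; ring_nf
    have e2 : (1 - ρ) * Real.exp (v * (s * ρ) ^ 2 / 2) +
        ρ / c * (S.card * Real.exp (v * ((s * ρ) ^ 2 + s ^ 2) / 2)) =
        Real.exp (v * (s * ρ) ^ 2 / 2) := by
      rw [e1]
      have : ρ / c * (S.card * (Real.exp (v * (s * ρ) ^ 2 / 2) * Real.exp (v * s ^ 2 / 2))) =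
          ρ / c * c * Real.exp (v * (s * ρ) ^ 2 / 2) := by rw [hc]; ring
      rw [this, div_mul_cancel₀ _ hc0.ne']; ring
    rw [e2, hc, Real.mul_rpow hK.le (Real.exp_pos _).le, ← Real.exp_mul, mul_assoc, mul_assoc,
      ← Real.exp_add, ← Real.exp_add]
    congr 2
    rw [hs]
    field_simp
    ring
  rw [← hint]
  refine le_trans ?_ (one_mul ((awgnNoise n v).real {z | 1 ≤ f z}) ▸
    mul_meas_ge_le_integral_of_nonneg (Eventually.of_forall hf0) hf 1)
  refine measureReal_mono ?_
  rintro z ⟨j, hj, hz⟩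
  set B : ℝ := ∑ j ∈ S, Real.exp (s * z j) with hB
  have hB0 : 0 < B := Finset.sum_pos (fun _ _ => Real.exp_pos _) hS
  have hBA : Real.exp (s * (A + z p)) ≤ B :=
    (Real.exp_le_exp.2 (mul_le_mul_of_nonneg_left hz hs0)).trans
      (Finset.single_le_sum (f := fun j => Real.exp (s * z j)) (fun _ _ => (Real.exp_pos _).le) hj)
  have hpow : Real.exp (s * (A + z p) * ρ) ≤ B ^ ρ := by
    rw [Real.exp_mul]; exact Real.rpow_le_rpow (Real.exp_pos _).le hBA hρ.le
  have hlin : B ^ ρ ≤ c ^ ρ * (1 + ρ * (B / c - 1)) := by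
    have h := rpow_one_add_le_one_add_mul_self (s := B / c - 1)
      (by linarith [div_pos hB0 hc0]) hρ.le hρ1
    rw [add_sub_cancel, Real.div_rpow hB0.le hc0.le, div_le_iff₀ (by positivity)] at h
    linarith
  have hfz : f z = Real.exp (-(s * (A + z p) * ρ)) * (c ^ ρ * (1 + ρ * (B / c - 1))) := by
    simp only [f, h0, h1, Real.exp_add, ← Finset.mul_sum, ← hB]
    have : Real.exp (-(s * (A + z p) * ρ)) =
      Real.exp (-(s * ρ * A)) * Real.exp (-(s * ρ) * z p) := by rw [← Real.exp_add]; ring_nf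
    rw [this]; ring
  change 1 ≤ f z
  rw [hfz]
  calc (1 : ℝ) = Real.exp (-(s * (A + z p) * ρ)) * Real.exp (s * (A + z p) * ρ) := by
        rw [← Real.exp_add]; simp
    _ ≤ _ := mul_le_mul_of_nonneg_left (hpow.trans hlin) (Real.exp_pos _).le

/-! ### The code: modular help in one step, pulses in the others. -/

/-- Ties are broken by the least index, which makes the choice measurable. -/
theorem exists_measurable_argmax {m : ℕ} (hm : 0 < m) :
    ∃ g : (Fin m → ℝ) → Fin m, Measurable g ∧ ∀ (f : Fin m → ℝ) i, f i ≤ f (g f) := by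
  classical
  have : Nonempty (Fin m) := ⟨⟨0, hm⟩⟩
  have hex : ∀ f : Fin m → ℝ, ∃ k, ∃ h : k < m, ∀ i, f i ≤ f ⟨k, h⟩ := fun f => by
    obtain ⟨j, hj⟩ := Finite.exists_max f
    exact ⟨j, j.2, hj⟩
  have hmeas : ∀ k, MeasurableSet {f : Fin m → ℝ | ∃ h : k < m, ∀ i, f i ≤ f ⟨k, h⟩} := fun k => by
    by_cases h : k < m
    · simp only [h, exists_true_left, Set.ofPred_forall]
      exact MeasurableSet.iInter fun i =>
        measurableSet_le (measurable_pi_apply _) (measurable_pi_apply _)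
    · simp [h]
  refine ⟨fun f => ⟨Nat.find (hex f), (Nat.find_spec (hex f)).1⟩, ?_,
    fun f => (Nat.find_spec (hex f)).2⟩
  have h := (measurable_from_top (f := fun k : ℕ => if h : k < m then (⟨k, h⟩ : Fin m)
    else ⟨0, hm⟩)).comp (measurable_find hex hmeas)
  convert h using 1
  funext f
  exact (dif_pos (Nat.find_spec (hex f)).1).symm

/-- The element of `Fin m` congruent to `x` modulo `N`, if there is one below `m`. -/
def residueFin (N : ℕ) {m : ℕ} (hm : 0 < m) (x : ℤ) : Fin m :=
  if h : (x % N).toNat < m then ⟨(x % N).toNat, h⟩ else ⟨0, hm⟩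

theorem residueFin_eq {N m : ℕ} (hm : 0 < m) (hmN : m ≤ N) {x : ℤ} {w : Fin m}
    (h : x ≡ w [ZMOD N]) : residueFin N hm x = w := by
  have hw : x % N = (w : ℕ) := by
    rw [h]; exact Int.emod_eq_of_lt (by positivity) (by have := w.2; omega)
  simp [residueFin, hw]

theorem coe_residueFin_self {N : ℕ} (hN : 0 < N) (x : ℤ) :
    ((residueFin N hN x : ℕ) : ℤ) = x % N := by
  have h0 := Int.emod_nonneg x (b := N) (by omega)
  have h1 := Int.emod_lt_of_pos x (b := N) (by omega)
  have : (x % N).toNat < N := by omega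
  simp only [residueFin, this, dif_pos]
  omega

namespace HelperSide

/-- The description as the transmitter uses it. -/
def txPart : HelperSide → ℕ → ℕ
  | transmitter, m => m
  | receiver, _ => 0

/-- The description as the receiver uses it. -/
def rxPart : HelperSide → ℕ → ℕ
  | transmitter, _ => 0
  | receiver, m => m

theorem txPart_add_rxPart (side : HelperSide) (m : ℕ) : side.txPart m + side.rxPart m = m := by
  cases side <;> simp [txPart, rxPart]

end HelperSide

/-- For any help location, `M₁ ≤ Mh` messages are conveyed without error in one time step, at any
positive energy `ε`: the helper describes the quantized noise modulo `Mh`. The other time steps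
are used for pulse position modulation with pulse energy `e`. -/
theorem exists_ppmBased_code (side : HelperSide) {n Mh M₁ M₂ : ℕ} (hM₁ : 0 < M₁) (hM₁h : M₁ ≤ Mh)
    (hM₂ : 0 < M₂) (hn : 1 + M₂ ≤ n) {v : ℝ≥0} (hv : 0 < v) {e ε : ℝ} (he : 0 ≤ e) (hε : 0 < ε) :
    ∃ c : HelperCode n Mh M₁ M₂, c.AssistsOnly side ∧ c.EnergyLE v (e + ε) ∧ c.IsPPMBased ∧
      (∀ w z, (c.decoded w z).1 = w.1) ∧
      ∀ w, ∀ ρ : ℝ, 0 < ρ → ρ ≤ 1 → c.errorProbLow v w ≤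
        ((M₂ : ℝ) - 1) ^ ρ * Real.exp (-(ρ * (e / v) / (2 * (1 + ρ)))) := by
  have : IsProbabilityMeasure (awgnNoise n v) := by unfold awgnNoise; infer_instance
  have hN : 0 < Mh := by omega
  obtain ⟨g, hgm, hg⟩ := exists_measurable_argmax hM₂
  let t₀ : Fin n := ⟨0, by omega⟩
  let pos : Fin M₂ → Fin n := fun j => ⟨1 + j, by omega⟩
  have hpos : Function.Injective pos := fun i j h => by
    have := congrArg Fin.val h; simp only [pos] at this; ext; omega
  -- Residues are below `Mh`, so inputs `a * residue` stay below `√ε`.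
  let a : ℝ := √ε / Mh
  have ha : 0 < a := by positivity
  have hquant : Measurable fun z : Fin n → ℝ => z t₀ / a := by fun_prop
  let x : Fin M₁ → Fin Mh → ℝ := fun w m =>
    a * (residueFin Mh hN ((w : ℤ) - side.txPart m) : ℕ)
  let c : HelperCode n Mh M₁ M₂ :=
    { help := fun z => residueFin Mh hN ⌊z t₀ / a⌋
      enc := fun w m t => if t = t₀ then x w.1 m else if t = pos w.2 then √e else 0
      dec := fun y m => (residueFin Mh hM₁ (⌊y t₀ / a⌋ - side.rxPart m), g fun j => y (pos j))
      measurable_help := by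
        exact (measurable_of_countable (residueFin Mh hN)).comp
          (Int.measurable_floor.comp hquant)
      measurable_dec := fun m => by
        refine Measurable.prodMk ?_ (hgm.comp (measurable_pi_lambda _ fun j =>
          measurable_pi_apply (pos j)))
        exact (measurable_of_countable fun i : ℤ => residueFin Mh hM₁ (i - side.rxPart m)).comp
          (Int.measurable_floor.comp hquant) }
  have hp0 : ∀ j, pos j ≠ t₀ := fun j h => by
    have := congrArg Fin.val h; simp only [pos, t₀] at this; omega
  refine ⟨c, ?_, ?_, ?_, ?_, ?_⟩
  · cases side
    · intro y m m'; rfl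
    · intro w m m'; rfl
  · intro w
    have hx : ∀ m, x w.1 m ^ 2 ≤ ε := fun m => by
      have h1 : ((residueFin Mh hN ((w.1 : ℤ) - side.txPart m) : ℕ) : ℝ) ≤ Mh := by
        exact_mod_cast (residueFin Mh hN _).2.le
      have h2 : x w.1 m ≤ √ε := by
        calc x w.1 m ≤ a * Mh := mul_le_mul_of_nonneg_left h1 ha.le
          _ = √ε := div_mul_cancel₀ _ (by positivity)
      calc x w.1 m ^ 2 ≤ √ε ^ 2 := pow_le_pow_left₀ (by positivity) h2 2
        _ = ε := Real.sq_sqrt hε.le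
    have hle : ∀ m, ∑ t, c.enc w m t ^ 2 ≤ e + ε := fun m => by
      calc ∑ t, c.enc w m t ^ 2
          ≤ ∑ t, ((if t = pos w.2 then e else 0) + if t = t₀ then ε else 0) := by
            refine Finset.sum_le_sum fun t _ => ?_
            by_cases h : t = t₀
            · subst h
              simp [c, (hp0 w.2).symm, hx]
            · by_cases h' : t = pos w.2
              · simp [c, h', hp0, Real.sq_sqrt he]
              · simp [c, h, h']
        _ = e + ε := by simp [Finset.sum_add_distrib]
    calc ∫ z, ∑ t, c.enc w (c.help z) t ^ 2 ∂(awgnNoise n v)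
        ≤ ∫ _, (e + ε) ∂(awgnNoise n v) :=
          integral_mono_of_nonneg (Eventually.of_forall fun z =>
            Finset.sum_nonneg fun t _ => sq_nonneg _) (integrable_const _)
            (Eventually.of_forall fun z => hle _)
      _ = e + ε := by simp
  · refine ⟨1, e, hn, he, ?_, ?_, ?_, ?_, ?_⟩
    · intro z z' h
      simp only [c, h t₀ (by simp [t₀])]
    · intro w w' m h t ht
      have : t = t₀ := by ext; simp only [t₀]; omega
      simp [c, this, h]
    · intro w m t ht
      have h0 : t ≠ t₀ := fun h => by subst h; simp [t₀] at ht
      simp [c, h0, Fin.ext_iff, pos]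
    · intro y y' m h
      simp only [c, h t₀ (by simp [t₀])]
    · intro y m s t h1 h2 h3
      have hs : s = pos ⟨s - 1, by omega⟩ := by ext; simp only [pos]; omega
      have ht : t = pos (c.dec y m).2 := by ext; simp only [pos]; omega
      rw [hs, ht]
      exact hg (fun j => y (pos j)) _
  · intro w z
    refine residueFin_eq hM₁ hM₁h ?_
    simp only [c, if_pos]
    set T : Fin Mh := residueFin Mh hN ⌊z t₀ / a⌋ with hT
    have hTm : (T : ℤ) ≡ ⌊z t₀ / a⌋ [ZMOD Mh] := by
      rw [hT, coe_residueFin_self]; exact Int.mod_modEq _ _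
    have hX : ((residueFin Mh hN ((w.1 : ℤ) - side.txPart T) : ℕ) : ℤ) ≡
        (w.1 : ℤ) - side.txPart T [ZMOD Mh] := by
      rw [coe_residueFin_self]; exact Int.mod_modEq _ _
    -- The input is an integer multiple of `a`, so it passes through the floor with no rounding
    -- error.
    have hfl : ⌊(x w.1 T + z t₀) / a⌋ =
        ((residueFin Mh hN ((w.1 : ℤ) - side.txPart T) : ℕ) : ℤ) + ⌊z t₀ / a⌋ := by
      rw [← Int.floor_natCast_add]
      congr 1
      simp only [x]
      field_simp
    have hsum : (side.txPart T : ℤ) + side.rxPart T = T := by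
      exact_mod_cast side.txPart_add_rxPart T
    rw [hfl]
    have := ((hX.add hTm.symm).sub_right (side.rxPart T : ℤ))
    convert this using 1
    linarith
  · intro w ρ hρ hρ1
    have hset : {z | (c.decoded w z).2 ≠ w.2} ⊆
        {z | ∃ j ∈ (Finset.univ.erase w.2).map ⟨pos, hpos⟩, √e + z (pos w.2) ≤ z j} := by
      intro z hz
      set j := (c.decoded w z).2 with hj
      have hjw : j ≠ w.2 := hz
      refine ⟨pos j, Finset.mem_map.2 ⟨j, by simp [hjw], rfl⟩, ?_⟩
      have := hg (fun j => c.enc w (c.help z) (pos j) + z (pos j)) w.2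
      have h2 : g (fun j => c.enc w (c.help z) (pos j) + z (pos j)) = j := rfl
      rw [h2] at this
      simpa [c, hp0, hpos.eq_iff, hjw] using this
    refine (measureReal_mono hset).trans ?_
    have := measure_exists_add_le_awgnNoise_le hv (pos w.2)
      ((Finset.univ.erase w.2).map ⟨pos, hpos⟩) (by simp) (√e) (Real.sqrt_nonneg _)
      hρ hρ1
    rw [Finset.card_map, Finset.card_erase_of_mem (Finset.mem_univ _), Finset.card_univ,
      Fintype.card_fin, Nat.cast_sub hM₂, Real.sq_sqrt he, Nat.cast_one] at this
    exact this

/-- The left side is stationary at `1 + ρ = √(γ / 2) / √ℓ`. This `ρ` is at most `1` exactly when `ℓ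
≥ γ / 8`; below that, the endpoint `ρ = 1` is used. -/
theorem exists_gallager_parameter {γ ℓ : ℝ} (hℓ : 0 ≤ ℓ) (hℓγ : ℓ < γ / 2) :
    ∃ ρ : ℝ, 0 < ρ ∧ ρ ≤ 1 ∧ ρ * ℓ - ρ * γ / (2 * (1 + ρ)) =
      -(if ℓ < γ / 8 then γ / 4 - ℓ else (√(γ / 2) - √ℓ) ^ 2) := by
  split_ifs with h
  · exact ⟨1, one_pos, le_rfl, by ring⟩
  · have hpos : 0 < ℓ := by linarith
    have hs : 0 < √ℓ := Real.sqrt_pos.2 hpos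
    have h1 : √ℓ < √(γ / 2) := Real.sqrt_lt_sqrt hℓ hℓγ
    have h2 : √(γ / 2) ≤ 2 * √ℓ := by
      rw [Real.sqrt_le_left (by positivity), mul_pow, Real.sq_sqrt hℓ]; linarith
    have e1 : ℓ = √ℓ ^ 2 := (Real.sq_sqrt hℓ).symm
    have e2 : γ = 2 * √(γ / 2) ^ 2 := by rw [Real.sq_sqrt (by linarith)]; ring
    refine ⟨√(γ / 2) / √ℓ - 1, ?_, ?_, ?_⟩
    · rw [sub_pos, one_lt_div hs]; exact h1
    · rw [sub_le_iff_le_add, div_le_iff₀ hs]; linarith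
    · generalize √ℓ = b at *
      generalize √(γ / 2) = a at *
      have ha : a ≠ 0 := by linarith
      subst e1 e2
      rw [add_sub_cancel]
      field_simp
      ring

/-- The number of messages that the help conveys: the largest number below `exp x`. -/
noncomputable def helpedCard (x : ℝ) : ℕ := ⌈Real.exp x⌉₊ - 1

theorem helpedCard_add_one (x : ℝ) : helpedCard x + 1 = ⌈Real.exp x⌉₊ := by
  have : 0 < ⌈Real.exp x⌉₊ := Nat.ceil_pos.2 (Real.exp_pos x)
  unfold helpedCard; omega

theorem helpedCard_lt_exp (x : ℝ) : (helpedCard x : ℝ) < Real.exp x :=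
  Nat.lt_ceil.1 (by have := helpedCard_add_one x; omega)

theorem le_helpedCard (x : ℝ) : x ≤ helpedCard x := by
  have h := Nat.le_ceil (Real.exp x)
  rw [← helpedCard_add_one] at h
  push_cast at h
  linarith [Real.add_one_le_exp x]

theorem log_helpedCard_lt {x : ℝ} (hx : 0 < x) : Real.log (helpedCard x) < x :=
  (Real.log_lt_iff_lt_exp (hx.trans_le (le_helpedCard x))).2 (helpedCard_lt_exp x)

theorem sub_log_helpedCard_le {x : ℝ} (hx : 0 < x) : x - Real.log (helpedCard x) ≤ x⁻¹ := by
  have hm : (0 : ℝ) < helpedCard x := hx.trans_le (le_helpedCard x)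
  have h := Nat.le_ceil (Real.exp x)
  rw [← helpedCard_add_one] at h
  push_cast at h
  have h1 : x ≤ Real.log ((helpedCard x : ℝ) + 1) := (Real.le_log_iff_exp_le (by positivity)).2 h
  have h2 : Real.log ((helpedCard x : ℝ) + 1) - Real.log (helpedCard x) ≤ (helpedCard x : ℝ)⁻¹ := by
    rw [← Real.log_div (by positivity) hm.ne']
    refine (Real.log_le_sub_one_of_pos (by positivity)).trans_eq ?_
    field_simp
    ring
  linarith [inv_anti₀ hx (le_helpedCard x)]

theorem tendsto_sub_log_helpedCard {r : ℝ} (hr : 0 < r) :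
    Tendsto (fun n : ℕ => n * r - Real.log (helpedCard (n * r))) atTop (𝓝 0) := by
  have ht : Tendsto (fun n : ℕ => (n * r : ℝ)) atTop atTop :=
    tendsto_natCast_atTop_atTop.atTop_mul_const hr
  have hpos := ht.eventually_gt_atTop 0
  refine squeeze_zero' ?_ ?_ (tendsto_inv_atTop_zero.comp ht)
  · filter_upwards [hpos] with n hn using (sub_pos.2 (log_helpedCard_lt hn)).le
  · filter_upwards [hpos] with n hn using sub_log_helpedCard_le hn

/-! ### Choice of parameters and conclusion. -/

theorem mainTheorem7 (side : HelperSide) (v : ℝ≥0) (hv : 0 < v) (E Rh : ℝ) (hE : 0 < E)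
    (hRh : 0 < Rh) :
    ∃ η : ℕ → ℝ, Tendsto η atTop (𝓝 0) ∧
      ∀ Einf : ℝ, 0 < Einf → ∀ δ : ℝ, 0 < δ → ∀ᶠ n : ℕ in atTop,
        ∀ M : ℕ, 1 ≤ M → Real.log M < (E / v) / 2 + n * Rh →
          ∃ (M₁ M₂ : ℕ) (c : HelperCode n ⌊Real.exp (n * Rh)⌋₊ M₁ M₂),
            1 ≤ M₁ ∧ M₂ = ⌈(M : ℝ) / M₁⌉₊ ∧
            c.AssistsOnly side ∧ c.EnergyLE v E ∧ c.IsPPMBased ∧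
            (∀ w, c.errorProb v w ≤
              Real.exp (η n) * Real.exp (-helperExponent (E / v) Rh Einf n (Real.log M))) ∧
            (n * Rh ≤ Real.log M →
              Real.log M₁ < n * Rh ∧ n * Rh - Real.log M₁ < δ ∧
              (∀ w, c.errorProbHigh v w ≤ Real.exp (-(n * Einf))) ∧
              (∀ w, c.errorProbLow v w ≤
                Real.exp (η n) *
                  Real.exp (-helperExponent (E / v) Rh Einf n (Real.log M)))) := by
  have hv' : (0 : ℝ) < v := hv
  set γ : ℝ := E / v with hγ
  have hγ0 : 0 < γ := by positivity
  have hκ := tendsto_sub_log_helpedCard hRh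
  -- Two losses: `log M₁` falls short of `n * Rh`, and the helped step takes the share `1 / (n + 1)`
  -- of the energy, where `ρ / (2 * (1 + ρ)) ≤ 1 / 4`.
  refine ⟨fun n => (n * Rh - Real.log (helpedCard (n * Rh))) + γ / 4 * (1 / ((n : ℝ) + 1)), ?_, ?_⟩
  · simpa using hκ.add ((tendsto_one_div_add_atTop_nhds_zero_nat (𝕜 := ℝ)).const_mul (γ / 4))
  intro Einf _ δ hδ
  filter_upwards [hκ.eventually_lt_const hδ, hκ.eventually_lt_const one_pos,
    eventually_ge_atTop (⌈Real.exp (γ / 2 + 1)⌉₊ + 1), eventually_ge_atTop 1]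
    with n hnδ hn1 hnM hn0 M hM hMlog
  have hnR : 0 < n * Rh := mul_pos (by exact_mod_cast hn0) hRh
  have hm : (0 : ℝ) < helpedCard (n * Rh) := hnR.trans_le (le_helpedCard _)
  have hlt := log_helpedCard_lt hnR
  have hM₁h : helpedCard (n * Rh) ≤ ⌊Real.exp (n * Rh)⌋₊ := Nat.le_floor (helpedCard_lt_exp _).le
  -- `M₁` is the largest integer strictly below `exp (n * Rh)`, so for `log M < n * Rh` a single
  -- pulse position suffices.
  have hMM : M < Real.exp (n * Rh) → M ≤ helpedCard (n * Rh) := fun h => by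
    have := Nat.lt_ceil.2 h
    rw [← helpedCard_add_one] at this
    omega
  generalize helpedCard (n * Rh) = M₁ at *
  have hM₁ : 0 < M₁ := by exact_mod_cast hm
  have hM0 : (0 : ℝ) < M := by exact_mod_cast hM
  set M₂ : ℕ := ⌈(M : ℝ) / M₁⌉₊ with hM₂
  have hM₂0 : 0 < M₂ := Nat.ceil_pos.2 (by positivity)
  have hquot : (M : ℝ) / M₁ = Real.exp (Real.log M - Real.log M₁) := by
    rw [Real.exp_sub, Real.exp_log hM0, Real.exp_log hm]
  have hM₂le : M₂ ≤ ⌈Real.exp (γ / 2 + 1)⌉₊ := Nat.ceil_mono <| by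
    rw [hquot]; exact Real.exp_le_exp.2 (by linarith)
  have hM₂1 : (M₂ : ℝ) - 1 ≤ Real.exp (Real.log M - Real.log M₁) := by
    rw [← hquot]; linarith [Nat.ceil_lt_add_one (show 0 ≤ (M : ℝ) / M₁ by positivity)]
  have hn' : (0 : ℝ) < (n : ℝ) + 1 := by positivity
  obtain ⟨c, hside, henergy, hppm, hhigh, hlow⟩ := exists_ppmBased_code side (n := n) hM₁ hM₁h hM₂0
    (by omega) hv (e := E * (1 - 1 / ((n : ℝ) + 1))) (ε := E * (1 / ((n : ℝ) + 1)))
    (mul_nonneg hE.le (sub_nonneg.2 ((div_le_one hn').2 (by simp)))) (by positivity)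
  have hlow' : ∀ w, c.errorProbLow v w ≤
      Real.exp ((n * Rh - Real.log M₁) + γ / 4 * (1 / ((n : ℝ) + 1))) *
        Real.exp (-helperExponent γ Rh Einf n (Real.log M)) := fun w => by
    by_cases hL : Real.log M < n * Rh
    · have hMM : (M : ℝ) ≤ M₁ := by
        exact_mod_cast hMM ((Real.log_lt_iff_lt_exp hM0).1 hL)
      have h1 : M₂ = 1 := by
        have : M₂ ≤ 1 := Nat.ceil_le.2 (by simpa using (div_le_one hm).2 hMM)
        omega
      refine (hlow w 1 one_pos le_rfl).trans ?_
      -- With one position the factor `M₂ - 1` vanishes: the error is zero, whatever `Einf`.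
      rw [h1, Nat.cast_one, sub_self, Real.rpow_one, zero_mul]
      positivity
    · obtain ⟨ρ, hρ, hρ1, hρe⟩ := exists_gallager_parameter (γ := γ) (ℓ := Real.log M - n * Rh)
        (by linarith) (by linarith)
      refine (hlow w ρ hρ hρ1).trans ?_
      have hexp : -helperExponent γ Rh Einf n (Real.log M) =
          ρ * (Real.log M - n * Rh) - ρ * γ / (2 * (1 + ρ)) := by
        rw [hρe, helperExponent, if_neg hL]
        split_ifs <;> ring
      have hpow : ((M₂ : ℝ) - 1) ^ ρ ≤ Real.exp ((Real.log M - Real.log M₁) * ρ) := by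
        rw [Real.exp_mul]
        refine Real.rpow_le_rpow (sub_nonneg.2 (by exact_mod_cast hM₂0)) hM₂1 hρ.le
      refine (mul_le_mul_of_nonneg_right hpow (Real.exp_pos _).le).trans ?_
      rw [← Real.exp_add, ← Real.exp_add, Real.exp_le_exp, hexp]
      have hq : 0 < 1 / ((n : ℝ) + 1) := by positivity
      have hr : ρ / (2 * (1 + ρ)) ≤ 1 / 4 := by
        rw [div_le_div_iff₀ (by positivity) (by positivity)]; linarith
      have h1 := mul_le_mul_of_nonneg_right hr (mul_pos hγ0 hq).le
      have h2 : ρ * (n * Rh - Real.log M₁) ≤ 1 * (n * Rh - Real.log M₁) :=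
        mul_le_mul_of_nonneg_right hρ1 (by linarith)
      have h3 : ρ * (E * (1 - 1 / ((n : ℝ) + 1)) / v) / (2 * (1 + ρ)) =
          ρ * γ / (2 * (1 + ρ)) - ρ / (2 * (1 + ρ)) * (γ * (1 / ((n : ℝ) + 1))) := by
        rw [hγ]; ring
      rw [h3]
      linarith
  refine ⟨M₁, M₂, c, hM₁, rfl, hside, ?_, hppm, fun w => ?_, fun _ => ⟨hlt, hnδ, fun w => ?_, hlow'⟩⟩
  · convert henergy using 1; ring
  · refine le_trans (le_of_eq ?_) (hlow' w)
    simp only [HelperCode.errorProb, HelperCode.errorProbLow, ne_eq, Prod.ext_iff, hhigh, true_and]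
  · simp only [HelperCode.errorProbHigh, hhigh, ne_eq, not_true_eq_false, Set.ofPred_false,
      measureReal_empty]
    positivity
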